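/- Let $m,n\ge 2$ and put $v=mn$. Write $I_r$, $J_r$ for the identity and the all-ones matrix of order $r$. A $v\times v$ $(0,1)$-matrix $A$ with pairwise distinct rows is the incidence matrix (rows $=$ blocks, columns $=$ points) of a symmetric group divisible design with parameters $(v,k,m,n,\lambda_1,\lambda_2)$, where $0<k<v$, if $$AA^\top=A^\top A=kI_v+\lambda_1(I_m\otimes J_n-I_v)+\lambda_2(J_v-I_m\otimes J_n);$$ it is proper if $\lambda_1\ne\lambda_2$. Let $f\ge 3$. A linked system of $f$ symmetric group divisible designs with parameters $(v,k,m,n,\lambda_1,\lambda_2)$ and linking numbers $\sigma,\tau\in\mathbb Z$ is a family of $v\times v$ $(0,1)$-matrices $A_{i,j}$ ($i,j\in\{1,\dots,f\}$, $i\ne j$), each the incidence matrix of a symmetric group divisible design with these parameters, such that $A_{i,j}^\top=A_{j,i}$ for all distinct $i,j$ and $$A_{i,j}A_{j,l}=\sigma A_{i,l}+\tau(J_v-A_{i,l})\qquad\text{for all distinct } i,j,l.$$ **Theorem.** Let $A_{i,j}$ ($i,j\in\{1,\dots,f\}$, $i\neq j$, $f\ge3$) be a linked system of proper symmetric group divisible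 designs with parameters $(v,k,m,n,\lambda_1,\lambda_2)$ and linking numbers $\sigma,\tau$. Then the following hold. 1. If $(m,n)=(k,2)$, then $f\le \frac m2+1$. 2. If $(m,n)\ne(k,2)$ and $mn-2k\ge0$, then $$f\le\frac{(m(n-1)+2)(m(n-1)-1)}{2(mn-1)}.$$ 3. If $(m,n)\ne(k,2)$, $mn-2k<0$ and $\sigma>\tau$, then $$f\le 1+\frac{m(n-2)}{(2k-mn)\sqrt{\frac{m(n-1)}{k(mn-k)}}}.$$ (If $\sigma<\tau$, then the complements $J_v-A_{i,j}$ form such a system with $k$ replaced by $mn-k$ and with $\sigma>\tau$, so the inequality $\sigma>\tau$ is a normalization.) -/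

import Mathlib

open scoped Matrix Kronecker

namespace LinkedGDD

/-- The index set of the `v = m * n` points: `(c, x)` is the `x`-th point of the class `c`. -/
abbrev Pt (m n : ℕ) : Type := Fin m × Fin n

/-- The all-ones matrix `J` with rows and columns indexed by `ι`. -/
def allOnes (ι : Type) : Matrix ι ι ℤ := Matrix.of fun _ _ => 1

/-- The matrix `I_m ⊗ J_n`: the entry at a pair of points is `1` if they lie in the same class,
and `0` otherwise. -/
def sameClass (m n : ℕ) : Matrix (Pt m n) (Pt m n) ℤ :=
  (1 : Matrix (Fin m) (Fin m) ℤ) ⊗ₖ allOnes (Fin n)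

/-- `A` is the incidence matrix of a symmetric group divisible design with parameters
`(v, k, m, n, lam₁, lam₂)`; rows are blocks and columns are points, both ordered by classes. -/
structure IsSymmetricGDD (v k m n lam₁ lam₂ : ℕ) (A : Matrix (Pt m n) (Pt m n) ℤ) : Prop where
  two_le_m : 2 ≤ m
  two_le_n : 2 ≤ n
  v_eq : v = m * n
  k_pos : 0 < k
  k_lt : k < v
  zero_or_one : ∀ p q, A p q = 0 ∨ A p q = 1
  /-- Distinct blocks are distinct sets of points. -/
  blocks_distinct : Function.Injective fun p => A p
  mul_transpose : A * Aᵀ = (k : ℤ) • (1 : Matrix (Pt m n) (Pt m n) ℤ)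
    + (lam₁ : ℤ) • (sameClass m n - 1) + (lam₂ : ℤ) • (allOnes (Pt m n) - sameClass m n)
  transpose_mul : Aᵀ * A = (k : ℤ) • (1 : Matrix (Pt m n) (Pt m n) ℤ)
    + (lam₁ : ℤ) • (sameClass m n - 1) + (lam₂ : ℤ) • (allOnes (Pt m n) - sameClass m n)

/-- The matrices `A i j`, for distinct `i, j`, form a linked system of `f` symmetric group
divisible designs with parameters `(v, k, m, n, lam₁, lam₂)` and linking numbers `σ, τ`.
The diagonal members `A i i` are not used. -/
structure IsLinkedSystem (f v k m n lam₁ lam₂ : ℕ) (σ τ : ℤ)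
    (A : Fin f → Fin f → Matrix (Pt m n) (Pt m n) ℤ) : Prop where
  design : ∀ i j, i ≠ j → IsSymmetricGDD v k m n lam₁ lam₂ (A i j)
  transpose_eq : ∀ i j, i ≠ j → (A i j)ᵀ = A j i
  linked : ∀ i j l, i ≠ j → j ≠ l → i ≠ l →
    A i j * A j l = σ • A i l + τ • (allOnes (Pt m n) - A i l)

end LinkedGDD

/-!
Put `s = σ - τ`. The linking equation, multiplied by its transpose, shows that
`(A i j * A j i) ^ 2` equals `s² (A i j * A j i)` up to a multiple of `J`. So both nontrivial
eigenvalues of `A i j * A j i` are `0` or `s²`; properness and distinctness of the blocks leave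
only `k - lam₁ = s²` and `k - lam₁ + n (lam₁ - lam₂) = 0` (`IsLinkedSystem.eigenvalues`). Hence
the matrices `B i j = (A i j - (k / v) J) / s`, completed by `B i i = E = I - I_m ⊗ (J_n / n)`,
satisfy `B i j * B j l = B i l` for all `i, j, l` (`IsLinkedSystem.isProjectionSystem`). Thus
`(B i j)` is the Gram matrix of `f v` vectors, the rows of the `B i o` for a fixed `o`, in the
range of `E`, a space of dimension `d = m (n - 1)`. Every block meets every class in `t = k / m`
points (`IsLinkedSystem.exists_class_intersection`).

Off the diagonal, entries of `B i j` take two values, so their squares are affine in the entries,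
with slope `c = (1 - 2 k / v) / s`. Consequently the Gram form of the tensor squares `xᵀ x` of
these vectors is explicit on coefficient vectors summing to zero over each index `i`
(`IsProjectionSystem.gramForm_eq`). It has the eigenvalues `1 - 2 / n - c`,
`1 - 2 / n + (f - 1) c` and `1 - 1 / n`, the last one on class-constant vectors.

* The form is nonnegative, so `0 ≤ 1 - 2 / n + (f - 1) c` (`IsProjectionSystem.relative_bound`).
  For `2 k > v` and `σ > τ`, where `c < 0`, this is the third bound.
* If `0 ≤ c < 1 - 2 / n`, the form is definite, and `f (v - 1)` independent traceless symmetric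
  matrices lie in a space of dimension `d (d + 1) / 2 - 1` (`IsProjectionSystem.absolute_bound`).
  This is the second bound when `σ > τ` or `2 k = v`.
* Class-constant vectors alone give `f (m - 1) ≤ d (d + 1) / 2 - 1`, which for `n = 2` is the
  first bound (`IsProjectionSystem.class_absolute_bound`).

The remaining case of the second bound is `2 k < v` with `σ < τ`, so that `c < 0`. Then the
relative bound is the stronger one, for arithmetic reasons: with `u = n - 2 t`, the number `n`
divides `m u²`, and `m u² = n` is impossible (`two_mul_le_of_params`), so `m u² ≥ 2 n`, which
makes the relative bound small enough (`absolute_of_relative`).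
-/

namespace LinkedGDD

/-! ### Projection systems -/

/-- The orthogonal projection `I - I_m ⊗ (J_n / n)` of `ℝ ^ (m * n)` onto the space of vectors
whose entries sum to zero over every class. -/
noncomputable def classProj (m n : ℕ) : Matrix (Pt m n) (Pt m n) ℝ :=
  Matrix.of fun p q => (if p = q then 1 else 0) - (if p.1 = q.1 then (n : ℝ)⁻¹ else 0)

/-- The matrices `B i j` are the blocks of a multiple of a projection: after completing the family
by the diagonal blocks `B i i = classProj m n`, products of consecutive members telescope.
Off the diagonal the entries of `B i j` are roots of one quadratic polynomial `X² - c X - e`. -/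
structure IsProjectionSystem {ι : Type} {m n : ℕ} (c e : ℝ)
    (B : ι → ι → Matrix (Pt m n) (Pt m n) ℝ) : Prop where
  diag : ∀ i, B i i = classProj m n
  transpose_eq : ∀ i j, (B i j)ᵀ = B j i
  mul : ∀ i j l, B i j * B j l = B i l
  entry_sq : ∀ i j, i ≠ j → ∀ p q, B i j p q ^ 2 = c * B i j p q + e

theorem classProj_mul_apply {m n : ℕ} (M : Matrix (Pt m n) (Pt m n) ℝ) (p q : Pt m n) :
    (classProj m n * M) p q = M p q - (n : ℝ)⁻¹ * ∑ x, M (p.1, x) q := by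
  simp only [Matrix.mul_apply, classProj, Matrix.of_apply, sub_mul, Finset.sum_sub_distrib]
  congr 1
  · simp
  · rw [Fintype.sum_prod_type]
    simp [ite_mul, Finset.mul_sum]

theorem trace_classProj {m n : ℕ} :
    (classProj m n).trace = (m : ℝ) * n * (1 - (n : ℝ)⁻¹) := by
  simp [Matrix.trace, classProj]
  ring

/-- A sum of squares of tensors `x α ⊗ x α` is governed by the squared Gram matrix. -/
theorem sum_sq_sum_tensor {α κ : Type} [Fintype α] [Fintype κ] (x : α → κ → ℝ) (a : α → ℝ) :
    ∑ r, ∑ r', (∑ z, a z * x z r * x z r') ^ 2 =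
      ∑ z, ∑ w, a z * a w * (∑ r, x z r * x w r) ^ 2 := by
  calc _ = ∑ y : κ × κ, ∑ z : α × α,
        a z.1 * a z.2 * ((x z.1 y.1 * x z.2 y.1) * (x z.1 y.2 * x z.2 y.2)) := by
        simp_rw [Fintype.sum_prod_type, sq, Finset.sum_mul_sum]
        refine Finset.sum_congr rfl fun _ _ => Finset.sum_congr rfl fun _ _ =>
          Finset.sum_congr rfl fun _ _ => Finset.sum_congr rfl fun _ _ => by ring
    _ = ∑ z : α × α, ∑ y : κ × κ,
        a z.1 * a z.2 * ((x z.1 y.1 * x z.2 y.1) * (x z.1 y.2 * x z.2 y.2)) := Finset.sum_comm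
    _ = _ := by
        simp_rw [Fintype.sum_prod_type, sq, Finset.sum_mul_sum, Finset.mul_sum]

/-- The square of the norm of a linear combination, in terms of the Gram matrix. -/
theorem sum_sq_sum_mul {α κ : Type} [Fintype α] [Fintype κ] (x : α → κ → ℝ) (a : α → ℝ) :
    ∑ r, (∑ z, a z * x z r) ^ 2 = ∑ z, ∑ w, a z * a w * ∑ r, x z r * x w r := by
  calc _ = ∑ r, ∑ z : α × α, a z.1 * a z.2 * (x z.1 r * x z.2 r) := by
        simp_rw [Fintype.sum_prod_type, sq, Finset.sum_mul_sum]
        refine Finset.sum_congr rfl fun _ _ => Finset.sum_congr rfl fun _ _ =>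
          Finset.sum_congr rfl fun _ _ => by ring
    _ = ∑ z : α × α, ∑ r, a z.1 * a z.2 * (x z.1 r * x z.2 r) := Finset.sum_comm
    _ = _ := by simp_rw [Fintype.sum_prod_type, Finset.mul_sum]

section

variable {ι : Type} {m n : ℕ}

/-- The symmetric matrix `∑ a (i, p) • xᵀ x`, where `x` is row `p` of `B i o`. -/
def tensorSum [Fintype ι] (B : ι → ι → Matrix (Pt m n) (Pt m n) ℝ) (o : ι) :
    (ι × Pt m n → ℝ) →ₗ[ℝ] Matrix (Pt m n) (Pt m n) ℝ where
  toFun a := Matrix.of fun r r' => ∑ z, a z * B z.1 o z.2 r * B z.1 o z.2 r'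
  map_add' a b := by
    ext r r'
    simp [add_mul, Finset.sum_add_distrib]
  map_smul' t a := by
    ext r r'
    simp [Finset.mul_sum, mul_assoc]

theorem tensorSum_apply [Fintype ι] (B : ι → ι → Matrix (Pt m n) (Pt m n) ℝ) (o : ι)
    (a : ι × Pt m n → ℝ) (r r' : Pt m n) :
    tensorSum B o a r r' = ∑ z, a z * B z.1 o z.2 r * B z.1 o z.2 r' := rfl

/-- The Gram form of the tensors `xᵀ x` evaluated at `a`. -/
def gramForm [Fintype ι] (B : ι → ι → Matrix (Pt m n) (Pt m n) ℝ) (a : ι × Pt m n → ℝ) : ℝ :=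
  ∑ z, ∑ w, a z * a w * B z.1 w.1 z.2 w.2 ^ 2

/-! ### Two dimension counts -/

/-- A linear space of symmetric matrices whose rows sum to zero over every class has dimension at
most `d (d + 1) / 2` with `d = m (n - 1)`: such a matrix is determined by the entries in which one
chosen point of each class is not involved. -/
theorem finrank_le_of_injective {V : Type} [AddCommGroup V] [Module ℝ V]
    (hn : 0 < n) (T : V →ₗ[ℝ] Matrix (Pt m n) (Pt m n) ℝ) (hT : Function.Injective T)
    (hsymm : ∀ a, (T a).IsSymm) (hsum : ∀ a p y, ∑ x, T a p (y, x) = 0) :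
    Module.finrank ℝ V ≤ (m * (n - 1) + 1).choose 2 := by
  let D := Fin m × {x : Fin n // x ≠ ⟨0, hn⟩}
  let g : D → Pt m n := fun d => (d.1, d.2.1)
  let R : V →ₗ[ℝ] (Sym2 D → ℝ) :=
    { toFun := fun a s => T a (g (Quot.out s).1) (g (Quot.out s).2)
      map_add' := fun a b => by ext; simp
      map_smul' := fun t a => by ext; simp }
  have hR : Function.Injective R := by
    rw [injective_iff_map_eq_zero]
    intro a ha
    have h1 : ∀ d d', T a (g d) (g d') = 0 := by
      intro d d'
      have h2 : T a (g (Quot.out s(d, d')).1) (g (Quot.out s(d, d')).2) = 0 := congrFun ha _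
      have h3 : s((Quot.out s(d, d')).1, (Quot.out s(d, d')).2) = s(d, d') :=
        Quot.out_eq s(d, d')
      rcases Sym2.eq_iff.1 h3 with ⟨e1, e2⟩ | ⟨e1, e2⟩
      · rwa [e1, e2] at h2
      · rw [e1, e2] at h2
        rw [← h2]
        exact (hsymm a).apply _ _
    have ext0 : ∀ p, (∀ d, T a p (g d) = 0) → ∀ q, T a p q = 0 := by
      rintro p hp ⟨y, x⟩
      by_cases hx : x = ⟨0, hn⟩
      · rw [← hsum a p y, Finset.sum_eq_single x]
        · exact fun x' _ hx' => hp (y, ⟨x', fun h => hx' (h.trans hx.symm)⟩)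
        · simp
      · exact hp (y, ⟨x, hx⟩)
    apply hT
    rw [map_zero]
    ext p q
    refine ext0 p (fun d => ?_) q
    rw [← (hsymm a).apply]
    exact ext0 _ (h1 d) p
  have h4 := LinearMap.finrank_le_finrank_of_injective hR
  rw [Module.finrank_fintype_fun_eq_card, Sym2.card] at h4
  simpa [D, Fintype.card_subtype_compl] using h4

/-- The space of families of functions on `X`, indexed by `ι`, each of which sums to zero. -/
def sumZero (ι X : Type) [Fintype X] : Submodule ℝ (ι × X → ℝ) :=
  LinearMap.ker (LinearMap.pi fun i : ι => ∑ x : X, LinearMap.proj (R := ℝ) (i, x))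

theorem mem_sumZero {X : Type} [Fintype X] {a : ι × X → ℝ} :
    a ∈ sumZero ι X ↔ ∀ i, ∑ x, a (i, x) = 0 := by
  simp [sumZero, funext_iff]

theorem card_mul_card_le_finrank_sumZero (ι X : Type) [Fintype ι] [Fintype X] :
    Fintype.card ι * Fintype.card X ≤ Module.finrank ℝ (sumZero ι X) + Fintype.card ι := by
  have h := LinearMap.finrank_range_add_finrank_ker
    (LinearMap.pi fun i : ι => ∑ x : X, LinearMap.proj (R := ℝ) (φ := fun _ : ι × X => ℝ) (i, x))
  have h2 := Submodule.finrank_le (LinearMap.range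
    (LinearMap.pi fun i : ι => ∑ x : X, LinearMap.proj (R := ℝ) (φ := fun _ : ι × X => ℝ) (i, x)))
  rw [Module.finrank_fintype_fun_eq_card] at h h2
  rw [Fintype.card_prod] at h
  unfold sumZero
  omega

/-! ### The Gram form of a projection system -/

namespace IsProjectionSystem

variable {c e : ℝ} {B : ι → ι → Matrix (Pt m n) (Pt m n) ℝ}

theorem sum_row_mul_row (h : IsProjectionSystem c e B) (o i j : ι) (p q : Pt m n) :
    ∑ r, B i o p r * B j o q r = B i j p q := by
  rw [← h.mul i o j, Matrix.mul_apply]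
  simp_rw [← h.transpose_eq j o, Matrix.transpose_apply]

theorem sum_col_mul_col (h : IsProjectionSystem c e B) (o i : ι) (q r : Pt m n) :
    ∑ p, B i o p q * B i o p r = classProj m n q r := by
  rw [← h.diag o, ← h.mul o i o, Matrix.mul_apply]
  simp_rw [← h.transpose_eq i o, Matrix.transpose_apply]

theorem sum_class (h : IsProjectionSystem c e B) (hn : n ≠ 0) (i j : ι) (b : Fin m)
    (q : Pt m n) : ∑ x, B i j (b, x) q = 0 := by
  have h1 := classProj_mul_apply (B i j) (b, ⟨0, Nat.pos_of_ne_zero hn⟩) q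
  rw [← h.diag i, h.mul i i j] at h1
  have hn' : (n : ℝ)⁻¹ ≠ 0 := by simpa using hn
  have h2 : (n : ℝ)⁻¹ * ∑ x, B i j (b, x) q = 0 := by linarith
  exact (mul_eq_zero.1 h2).resolve_left hn'

theorem sum_class_right (h : IsProjectionSystem c e B) (hn : n ≠ 0) (i j : ι) (b : Fin m)
    (p : Pt m n) : ∑ x, B i j p (b, x) = 0 := by
  rw [← h.sum_class hn j i b p, ← h.transpose_eq i j]
  rfl

/-- The Gram matrix of the rows of the `B i o` is `(B i j)`, so that of their tensor squares is
the matrix of squared entries. -/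
theorem sum_sq_tensorSum [Fintype ι] (h : IsProjectionSystem c e B) (o : ι) (a : ι × Pt m n → ℝ) :
    ∑ r, ∑ r', tensorSum B o a r r' ^ 2 = gramForm B a := by
  simp_rw [tensorSum_apply]
  rw [sum_sq_sum_tensor (fun z : ι × Pt m n => B z.1 o z.2) a]
  simp_rw [h.sum_row_mul_row, gramForm]

theorem gramForm_nonneg [Fintype ι] (h : IsProjectionSystem c e B) (o : ι) (a : ι × Pt m n → ℝ) :
    0 ≤ gramForm B a := by
  rw [← h.sum_sq_tensorSum o]
  positivity

/-- Entrywise squares of the blocks, as bilinear forms. The constant `e` disappears because `a` sums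
to zero; the diagonal blocks deviate from `c • B i i` by a combination of `I` and `I_m ⊗ J_n`. -/
theorem sum_sum_entry_sq (h : IsProjectionSystem c e B) [DecidableEq ι] (a b : Pt m n → ℝ)
    (i j : ι) (ha : ∑ p, a p = 0) (hab : i = j → a = b) :
    ∑ p, ∑ q, a p * b q * B i j p q ^ 2 = c * ∑ p, ∑ q, a p * b q * B i j p q +
      if i = j then (1 - 2 * (n : ℝ)⁻¹ - c) * ∑ p, a p ^ 2 +
        ((n : ℝ)⁻¹ ^ 2 + c * (n : ℝ)⁻¹) * ∑ y, (∑ x, a (y, x)) ^ 2 else 0 := by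
  split_ifs with hij
  · obtain rfl := hab hij
    subst hij
    have key : ∀ p q, a p * a q * B i i p q ^ 2 = c * (a p * a q * B i i p q) +
        ((1 - 2 * (n : ℝ)⁻¹ - c) * (if p = q then a p * a q else 0) +
        ((n : ℝ)⁻¹ ^ 2 + c * (n : ℝ)⁻¹) * (if p.1 = q.1 then a p * a q else 0)) := by
      intro p q
      rw [h.diag i]
      simp only [classProj, Matrix.of_apply]
      by_cases hpq : p = q
      · subst hpq
        simp
        ring
      · by_cases h1 : p.1 = q.1
        · simp [hpq, h1]
          ring
        · simp [hpq, h1]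
    simp_rw [key, Finset.sum_add_distrib, ← Finset.mul_sum]
    congr 2
    · simp [sq]
    · congr 1
      simp_rw [Fintype.sum_prod_type, sq, Finset.sum_mul_sum]
      refine Finset.sum_congr rfl fun y _ => Finset.sum_congr rfl fun x _ => ?_
      rw [Finset.sum_eq_single y (fun y' _ hy => by simp [hy.symm]) (by simp)]
      simp
  · simp_rw [h.entry_sq i j hij, mul_add, Finset.sum_add_distrib, Finset.mul_sum]
    congr 1
    · refine Finset.sum_congr rfl fun _ _ => Finset.sum_congr rfl fun _ _ => by ring
    · simp_rw [← Finset.sum_mul, ← Finset.sum_mul_sum, ha]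
      simp

/-- On coefficient vectors that sum to zero over each `{i} × Pt m n`, the Gram form is diagonal up
to `c` times a square. -/
theorem gramForm_eq [Fintype ι] (h : IsProjectionSystem c e B) (o : ι) (a : ι × Pt m n → ℝ)
    (ha : ∀ i, ∑ p, a (i, p) = 0) :
    gramForm B a = (1 - 2 * (n : ℝ)⁻¹ - c) * ∑ i, ∑ p, a (i, p) ^ 2 +
      ((n : ℝ)⁻¹ ^ 2 + c * (n : ℝ)⁻¹) * ∑ i, ∑ y, (∑ x, a (i, y, x)) ^ 2 +
      c * ∑ r, (∑ i, ∑ p, a (i, p) * B i o p r) ^ 2 := by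
  classical
  have h1 := sum_sq_sum_mul (fun z : ι × Pt m n => B z.1 o z.2) a
  have swap : ∀ F : ι → Pt m n → ι → Pt m n → ℝ,
      ∑ i, ∑ p, ∑ j, ∑ q, F i p j q = ∑ i, ∑ j, ∑ p, ∑ q, F i p j q :=
    fun F => Finset.sum_congr rfl fun _ _ => Finset.sum_comm
  simp only [h.sum_row_mul_row, Fintype.sum_prod_type (α₁ := ι)] at h1
  rw [h1]
  simp_rw [gramForm, Fintype.sum_prod_type (α₁ := ι)]
  rw [swap, swap]
  have h2 := fun i j => h.sum_sum_entry_sq (fun p => a (i, p)) (fun p => a (j, p)) i j (ha i)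
    (by rintro rfl; rfl)
  simp_rw [h2, Finset.sum_add_distrib, Finset.sum_ite_eq, Finset.mem_univ, if_true,
    Finset.sum_add_distrib, ← Finset.mul_sum]
  ring

/-! ### Bounds for projection systems -/

/-- The relative bound: the Gram form is nonnegative at the column `(i, p) ↦ B i o p q`, which is an
eigenvector of the block matrix `(B i j)` for its nonzero eigenvalue. -/
theorem relative_bound [Fintype ι] (h : IsProjectionSystem c e B)
    (hn : 2 ≤ n) (hm : 0 < m) (o : ι) :
    0 ≤ 1 - 2 * (n : ℝ)⁻¹ + (Fintype.card ι - 1) * c := by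
  have hn0 : n ≠ 0 := by omega
  let q : Pt m n := (⟨0, hm⟩, ⟨0, by omega⟩)
  let a : ι × Pt m n → ℝ := fun z => B z.1 o z.2 q
  have h0 := h.gramForm_nonneg o a
  rw [h.gramForm_eq o a fun i => by
    simp only [a]
    rw [Fintype.sum_prod_type]
    simp [h.sum_class hn0]] at h0
  have hsq : ∀ i, ∑ p, a (i, p) ^ 2 = 1 - (n : ℝ)⁻¹ := fun i => by
    simp only [sq, a, h.sum_col_mul_col]
    simp [classProj]
  have hpr : ∀ i r, ∑ p, a (i, p) * B i o p r = classProj m n q r := fun i r => by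
    simp only [a, h.sum_col_mul_col]
  have hE : ∑ r, classProj m n q r ^ 2 = 1 - (n : ℝ)⁻¹ := by
    rw [← hsq o]
    refine Finset.sum_congr rfl fun r _ => ?_
    rw [← h.diag o, ← h.transpose_eq o o]
    rfl
  have hcl : ∀ i y, ∑ x, a (i, y, x) = 0 := fun i y => h.sum_class hn0 i o y q
  simp_rw [hsq, hpr, hcl] at h0
  simp only [Finset.sum_const, Finset.card_univ, nsmul_eq_mul, mul_pow, ← Finset.mul_sum, hE]
    at h0
  have hf : (0 : ℝ) < Fintype.card ι := by
    exact_mod_cast Fintype.card_pos_iff.2 ⟨o⟩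
  have hn1 : (0 : ℝ) < 1 - (n : ℝ)⁻¹ := by
    have : (n : ℝ)⁻¹ < 1 := inv_lt_one_of_one_lt₀ (by exact_mod_cast (by omega : 1 < n))
    linarith
  have : 0 ≤ (Fintype.card ι * (1 - (n : ℝ)⁻¹)) *
      (1 - 2 * (n : ℝ)⁻¹ + (Fintype.card ι - 1) * c) := by
    convert h0 using 1
    simp
    ring
  exact nonneg_of_mul_nonneg_right this (by positivity)

/-- If the Gram form is definite on the image of `L`, the traceless matrices
`tensorSum B o (L a)` together with `classProj m n` span a space of dimension one more than that
of the source of `L`. -/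
theorem finrank_add_one_le [Fintype ι] (h : IsProjectionSystem c e B)
    (hn : 2 ≤ n) (hm : 0 < m) (o : ι)
    {V : Type} [AddCommGroup V] [Module ℝ V] [Module.Finite ℝ V]
    (L : V →ₗ[ℝ] (ι × Pt m n → ℝ)) (hL : ∀ a i, ∑ p, L a (i, p) = 0)
    (hdef : ∀ a, gramForm B (L a) = 0 → a = 0) :
    Module.finrank ℝ V + 1 ≤ (m * (n - 1) + 1).choose 2 := by
  have hn0 : n ≠ 0 := by omega
  let T : V × ℝ →ₗ[ℝ] Matrix (Pt m n) (Pt m n) ℝ :=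
    ((tensorSum B o).comp L).coprod (LinearMap.toSpanSingleton ℝ _ (classProj m n))
  have hTa : ∀ a, T a = tensorSum B o (L a.1) + a.2 • classProj m n := fun a => by
    simp [T]
  have htr : ∀ a, (tensorSum B o (L a)).trace = 0 := by
    intro a
    simp only [Matrix.trace, Matrix.diag_apply, tensorSum_apply]
    rw [Finset.sum_comm]
    simp_rw [mul_assoc, ← Finset.mul_sum, h.sum_row_mul_row, h.diag]
    rw [Fintype.sum_prod_type]
    simp [classProj, ← Finset.sum_mul, hL]
  have h1 := finrank_le_of_injective (by omega) T ?_ ?_ ?_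
  · simpa using h1
  · rw [injective_iff_map_eq_zero]
    rintro ⟨a, r⟩ h0
    rw [hTa] at h0
    have h2 := congrArg Matrix.trace h0
    rw [Matrix.trace_add, htr, Matrix.trace_smul, trace_classProj] at h2
    have hn1 : (n : ℝ)⁻¹ < 1 := inv_lt_one_of_one_lt₀ (by exact_mod_cast (by omega : 1 < n))
    have hr : r = 0 := by
      have : (m : ℝ) * n * (1 - (n : ℝ)⁻¹) ≠ 0 :=
        mul_ne_zero (mul_ne_zero (by exact_mod_cast hm.ne') (by exact_mod_cast hn0))
          (by linarith)
      simpa [this] using h2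
    subst hr
    have h3 : tensorSum B o (L a) = 0 := by simpa using h0
    have h4 := h.sum_sq_tensorSum o (L a)
    rw [h3] at h4
    simp only [Matrix.zero_apply] at h4
    rw [hdef a (by rw [← h4]; simp)]
    rfl
  · intro a
    rw [hTa]
    refine Matrix.IsSymm.add ?_ (Matrix.IsSymm.smul ?_ _)
    · refine Matrix.IsSymm.ext fun r r' => ?_
      simp_rw [tensorSum_apply]
      exact Finset.sum_congr rfl fun _ _ => by ring
    · rw [← h.diag o]
      exact h.transpose_eq o o
  · intro a p y
    simp_rw [hTa, Matrix.add_apply, Matrix.smul_apply, Finset.sum_add_distrib, ← h.diag o,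
      smul_eq_mul, ← Finset.mul_sum, h.sum_class_right hn0, tensorSum_apply]
    rw [Finset.sum_comm]
    simp_rw [← Finset.mul_sum, h.sum_class_right hn0]
    simp

/-- The absolute bound, for `0 ≤ c < 1 - 2 / n`. -/
theorem absolute_bound [Fintype ι] (h : IsProjectionSystem c e B)
    (hn : 2 ≤ n) (hm : 0 < m) (o : ι)
    (hc : 0 ≤ c) (hc' : c < 1 - 2 * (n : ℝ)⁻¹) :
    Fintype.card ι * (m * n) + 1 ≤ (m * (n - 1) + 1).choose 2 + Fintype.card ι := by
  have h1 := h.finrank_add_one_le hn hm o (sumZero ι (Pt m n)).subtype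
    (fun a => mem_sumZero.1 a.2) ?_
  · have h2 := card_mul_card_le_finrank_sumZero ι (Pt m n)
    simp only [Fintype.card_prod, Fintype.card_fin] at h2
    omega
  · rintro ⟨a, ha⟩ h0
    rw [Submodule.subtype_apply, h.gramForm_eq o a (mem_sumZero.1 ha)] at h0
    -- All three terms of the form are nonnegative, and the first one is definite.
    have h3 : 0 ≤ ((n : ℝ)⁻¹ ^ 2 + c * (n : ℝ)⁻¹) * ∑ i, ∑ y, (∑ x, a (i, y, x)) ^ 2 := by
      positivity
    have h4 : 0 ≤ c * ∑ r, (∑ i, ∑ p, a (i, p) * B i o p r) ^ 2 := by positivity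
    have h5 : ∑ z, a z ^ 2 ≤ 0 := by
      rw [Fintype.sum_prod_type]
      by_contra! h6
      nlinarith
    have h7 := (Finset.sum_eq_zero_iff_of_nonneg fun z _ => sq_nonneg (a z)).1
      (le_antisymm h5 (by positivity))
    refine Subtype.ext (funext fun z => ?_)
    simpa using h7 z (Finset.mem_univ z)

/-- The absolute bound from class-constant coefficient vectors, which needs no condition
on `c`. -/
theorem class_absolute_bound [Fintype ι] (h : IsProjectionSystem c e B)
    (hn : 2 ≤ n) (hm : 0 < m) (o : ι) :
    Fintype.card ι * m + 1 ≤ (m * (n - 1) + 1).choose 2 + Fintype.card ι := by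
  have hn0 : n ≠ 0 := by omega
  have h1 := h.finrank_add_one_le hn hm o
    ((LinearMap.funLeft ℝ ℝ fun z : ι × Pt m n => (z.1, z.2.1)).comp
      (sumZero ι (Fin m)).subtype)
    (fun a i => ?_) ?_
  · have h2 := card_mul_card_le_finrank_sumZero ι (Fin m)
    simp only [Fintype.card_fin] at h2
    omega
  · rw [Fintype.sum_prod_type]
    simp [LinearMap.funLeft_apply, ← Finset.mul_sum, mem_sumZero.1 a.2 i]
  · rintro ⟨b, hb⟩ h0
    have hb' := mem_sumZero.1 hb
    set a : ι × Pt m n → ℝ := fun z => b (z.1, z.2.1) with ha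
    change gramForm B a = 0 at h0
    rw [h.gramForm_eq o a fun i => by
      rw [Fintype.sum_prod_type]
      simp [ha, ← Finset.mul_sum, hb' i]] at h0
    have h3 : ∀ i r, ∑ p, a (i, p) * B i o p r = 0 := fun i r => by
      rw [Fintype.sum_prod_type]
      simp [ha, ← Finset.mul_sum, h.sum_class hn0]
    have h4 : ∀ i, ∑ p, a (i, p) ^ 2 = n * ∑ y, b (i, y) ^ 2 := fun i => by
      rw [Fintype.sum_prod_type]
      simp [ha, ← Finset.mul_sum]
    have h5 : ∀ i, ∑ y, (∑ x, a (i, y, x)) ^ 2 = n ^ 2 * ∑ y, b (i, y) ^ 2 := fun i => by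
      simp [ha, mul_pow, ← Finset.mul_sum]
    simp_rw [h3, h4, h5, ← Finset.mul_sum] at h0
    have hnR : (n : ℝ) ≠ 0 := by exact_mod_cast hn0
    -- The terms with coefficient `c` cancel on class-constant vectors.
    have h6 : ((n : ℝ) - 1) * ∑ i, ∑ y, b (i, y) ^ 2 = 0 := by
      rw [← h0]
      simp
      field_simp
      ring
    have hn1 : (n : ℝ) - 1 ≠ 0 := by
      have : (2 : ℝ) ≤ n := by exact_mod_cast hn
      intro h
      linarith
    have h7 : ∑ z, b z ^ 2 = 0 := by
      rw [Fintype.sum_prod_type]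
      exact (mul_eq_zero.1 h6).resolve_left hn1
    have h8 := (Finset.sum_eq_zero_iff_of_nonneg fun z _ => sq_nonneg (b z)).1 h7
    refine Subtype.ext (funext fun z => ?_)
    simpa using h8 z (Finset.mem_univ z)

end IsProjectionSystem

end

/-! ### Parameters of linked systems -/

theorem sameClass_apply {m n : ℕ} (p q : Pt m n) :
    sameClass m n p q = if p.1 = q.1 then 1 else 0 := by
  simp [sameClass, allOnes, Matrix.kroneckerMap_apply, Matrix.one_apply]

theorem sum_ite_class {m n : ℕ} (b : Fin m) :
    ∑ r : Pt m n, (if b = r.1 then (1 : ℤ) else 0) = n := by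
  rw [Fintype.sum_prod_type_right]
  simp

namespace IsSymmetricGDD

variable {v k m n lam₁ lam₂ : ℕ} {A : Matrix (Pt m n) (Pt m n) ℤ}

theorem mul_transpose_apply (h : IsSymmetricGDD v k m n lam₁ lam₂ A) (p q : Pt m n) :
    (A * Aᵀ) p q = if p = q then (k : ℤ) else if p.1 = q.1 then (lam₁ : ℤ) else lam₂ := by
  rw [h.mul_transpose]
  simp only [Matrix.add_apply, Matrix.smul_apply, Matrix.sub_apply, Matrix.one_apply,
    sameClass_apply, allOnes, Matrix.of_apply, smul_eq_mul]
  by_cases hpq : p = q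
  · subst hpq
    simp
  · by_cases h1 : p.1 = q.1 <;> simp [hpq, h1]

/-- The entries of `A * Aᵀ` in terms of the eigenvalue `k - lam₁`. -/
theorem mul_transpose_apply_eq (h : IsSymmetricGDD v k m n lam₁ lam₂ A) (p q : Pt m n) :
    (A * Aᵀ) p q = ((k : ℤ) - lam₁) * (if p = q then 1 else 0) +
      ((lam₁ : ℤ) - lam₂) * (if p.1 = q.1 then 1 else 0) + lam₂ := by
  rw [h.mul_transpose_apply]
  by_cases hpq : p = q
  · subst hpq
    simp
  · by_cases h1 : p.1 = q.1 <;> simp [hpq, h1]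

theorem entry_sq (h : IsSymmetricGDD v k m n lam₁ lam₂ A) (p q : Pt m n) :
    A p q * A p q = A p q := by
  rcases h.zero_or_one p q with h | h <;> simp [h]

theorem row_sum (h : IsSymmetricGDD v k m n lam₁ lam₂ A) (p : Pt m n) :
    ∑ q, A p q = k := by
  have h1 := h.mul_transpose_apply p p
  rw [Matrix.mul_apply] at h1
  simpa [h.entry_sq] using h1

theorem col_sum (h : IsSymmetricGDD v k m n lam₁ lam₂ A) (q : Pt m n) :
    ∑ p, A p q = k := by
  have h1 : (Aᵀ * A) q q = k := by
    rw [h.transpose_mul, ← h.mul_transpose, h.mul_transpose_apply]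
    simp
  rw [Matrix.mul_apply] at h1
  simpa [h.entry_sq] using h1

/-- Rows of `A` with inner product `k` coincide. -/
theorem lam₁_ne (h : IsSymmetricGDD v k m n lam₁ lam₂ A) : lam₁ ≠ k := by
  intro hk
  have hm := h.two_le_m
  have hn := h.two_le_n
  let p : Pt m n := (⟨0, by omega⟩, ⟨0, by omega⟩)
  let q : Pt m n := (⟨0, by omega⟩, ⟨1, by omega⟩)
  have hpq : p ≠ q := by simp [p, q]
  have h1 := h.mul_transpose_apply p q
  rw [if_neg hpq, if_pos rfl, hk, Matrix.mul_apply] at h1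
  refine hpq (h.blocks_distinct (funext fun r => ?_))
  have h2 : ∑ r, (A p r - A q r) ^ 2 = 0 := by
    have h3 : ∀ r, (A p r - A q r) ^ 2 = A p r + A q r - 2 * (A p r * Aᵀ r q) := fun r => by
      rw [Matrix.transpose_apply]
      linear_combination h.entry_sq p r + h.entry_sq q r
    simp_rw [h3, Finset.sum_sub_distrib, Finset.sum_add_distrib, ← Finset.mul_sum, h.row_sum, h1]
    ring
  have h4 := (Finset.sum_eq_zero_iff_of_nonneg fun r _ => sq_nonneg (A p r - A q r)).1 h2 r
    (Finset.mem_univ r)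
  have h5 : A p r - A q r = 0 := by simpa using h4
  linarith

end IsSymmetricGDD

variable {f v k m n lam₁ lam₂ : ℕ} {σ τ : ℤ} {A : Fin f → Fin f → Matrix (Pt m n) (Pt m n) ℤ}

namespace IsLinkedSystem

theorem mul_apply (h : IsLinkedSystem f v k m n lam₁ lam₂ σ τ A) {i j l : Fin f}
    (hij : i ≠ j) (hjl : j ≠ l) (hil : i ≠ l) (p q : Pt m n) :
    (A i j * A j l) p q = (σ - τ) * A i l p q + τ := by
  rw [h.linked i j l hij hjl hil]
  simp only [Matrix.add_apply, Matrix.smul_apply, Matrix.sub_apply, allOnes, Matrix.of_apply,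
    smul_eq_mul]
  ring

theorem exists_distinct (hf : 3 ≤ f) : ∃ i j l : Fin f, i ≠ j ∧ j ≠ l ∧ i ≠ l :=
  ⟨⟨0, by omega⟩, ⟨1, by omega⟩, ⟨2, by omega⟩, by simp, by simp, by simp⟩

/-- Row sums of the linking equation. -/
theorem k_sq (h : IsLinkedSystem f v k m n lam₁ lam₂ σ τ A) (hf : 3 ≤ f) :
    (k : ℤ) ^ 2 = (σ - τ) * k + τ * v := by
  obtain ⟨i, j, l, hij, hjl, hil⟩ := exists_distinct hf
  have hm := (h.design i j hij).two_le_m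
  have hn := (h.design i j hij).two_le_n
  let p : Pt m n := (⟨0, by omega⟩, ⟨0, by omega⟩)
  have h1 : ∑ q, (A i j * A j l) p q = ∑ q, ((σ - τ) * A i l p q + τ) :=
    Finset.sum_congr rfl fun q _ => h.mul_apply hij hjl hil p q
  simp_rw [Matrix.mul_apply] at h1
  rw [Finset.sum_comm] at h1
  simp_rw [Finset.sum_add_distrib, ← Finset.mul_sum, (h.design j l hjl).row_sum,
    (h.design i l hil).row_sum, ← Finset.sum_mul, (h.design i j hij).row_sum] at h1
  simp only [Finset.sum_const, Finset.card_univ, Fintype.card_prod, Fintype.card_fin,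
    nsmul_eq_mul] at h1
  rw [(h.design i j hij).v_eq, sq, h1]
  push_cast
  ring

/-- The product of two equal matrices `α I + β (I_m ⊗ J_n) + γ J`, entrywise. -/
theorem sum_pt_eq (m n : ℕ) (α β γ : ℤ) (p q : Pt m n) :
    (∑ r, (α * (if p = r then 1 else 0) + β * (if p.1 = r.1 then 1 else 0) + γ) *
      (α * (if r = q then 1 else 0) + β * (if r.1 = q.1 then 1 else 0) + γ)) =
    α ^ 2 * (if p = q then 1 else 0) + (2 * α * β + n * β ^ 2) * (if p.1 = q.1 then 1 else 0) +
      (2 * α * γ + 2 * n * β * γ + m * n * γ ^ 2) := by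
  simp only [add_mul, mul_add, Finset.sum_add_distrib]
  have e1 : ∑ r : Pt m n, α * (if p = r then 1 else 0) * (α * (if r = q then 1 else 0)) =
      α ^ 2 * (if p = q then 1 else 0) := by
    simp [sq, mul_comm]
  have e2 : ∑ r : Pt m n, β * (if p.1 = r.1 then 1 else 0) * (α * (if r = q then 1 else 0)) =
      α * β * (if p.1 = q.1 then 1 else 0) := by
    simp [mul_comm]
  have e3 : ∑ r : Pt m n, γ * (α * (if r = q then 1 else 0)) = α * γ := by
    simp [mul_comm]
  have e4 : ∑ r : Pt m n, α * (if p = r then 1 else 0) * (β * (if r.1 = q.1 then 1 else 0)) =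
      α * β * (if p.1 = q.1 then 1 else 0) := by
    rw [Finset.sum_eq_single p (fun r _ hr => by simp [hr.symm]) (by simp), if_pos rfl]
    ring
  have e5 : ∑ r : Pt m n, β * (if p.1 = r.1 then 1 else 0) *
      (β * (if r.1 = q.1 then 1 else 0)) = n * β ^ 2 * (if p.1 = q.1 then 1 else 0) := by
    rw [Fintype.sum_prod_type]
    simp
    ring_nf
  have e6 : ∑ r : Pt m n, γ * (β * (if r.1 = q.1 then 1 else 0)) = n * β * γ := by
    simp_rw [← Finset.mul_sum, eq_comm (b := q.1), sum_ite_class]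
    ring
  have e7 : ∑ r : Pt m n, α * (if p = r then 1 else 0) * γ = α * γ := by simp
  have e8 : ∑ r : Pt m n, β * (if p.1 = r.1 then 1 else 0) * γ = n * β * γ := by
    simp_rw [← Finset.sum_mul, ← Finset.mul_sum, sum_ite_class]
    ring
  have e9 : ∑ r : Pt m n, γ * γ = m * n * γ ^ 2 := by
    simp only [Finset.sum_const, Finset.card_univ, Fintype.card_prod, Fintype.card_fin,
      nsmul_eq_mul]
    push_cast
    ring
  rw [e1, e2, e3, e4, e5, e6, e7, e8, e9]
  ring

/-- The two nontrivial eigenvalues `k - lam₁` and `k - lam₁ + n (lam₁ - lam₂)` of `A i j * A j i`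
are `(σ - τ) ^ 2` and `0`: each is a root of `X² = (σ - τ)² X`, they differ, and the first one
is not zero. -/
theorem eigenvalues (h : IsLinkedSystem f v k m n lam₁ lam₂ σ τ A) (hf : 3 ≤ f)
    (hproper : lam₁ ≠ lam₂) :
    (k : ℤ) - lam₁ = (σ - τ) ^ 2 ∧ (k : ℤ) - lam₁ + n * (lam₁ - lam₂) = 0 := by
  obtain ⟨i, j, l, hij, hjl, hil⟩ := exists_distinct hf
  have hm := (h.design i j hij).two_le_m
  have hn := (h.design i j hij).two_le_n
  -- Both inner factors of `A i j * A j l * (A j l)ᵀ * (A i j)ᵀ` may be replaced, since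
  -- `A j l * (A j l)ᵀ = (A i j)ᵀ * A i j`.
  have hM : (A i j * A j l) * (A i j * A j l)ᵀ = (A i j * (A i j)ᵀ) * (A i j * (A i j)ᵀ) := by
    rw [Matrix.transpose_mul, Matrix.mul_assoc, ← Matrix.mul_assoc (A j l),
      (h.design j l hjl).mul_transpose, ← (h.design i j hij).transpose_mul]
    simp only [Matrix.mul_assoc]
  have hlhs : ∀ p q, ((A i j * A j l) * (A i j * A j l)ᵀ) p q =
      (σ - τ) ^ 2 * (A i l * (A i l)ᵀ) p q + (2 * (σ - τ) * τ * k + m * n * τ ^ 2) := by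
    intro p q
    rw [Matrix.mul_apply, Matrix.mul_apply]
    simp_rw [Matrix.transpose_apply, h.mul_apply hij hjl hil]
    have e : ∀ r, ((σ - τ) * A i l p r + τ) * ((σ - τ) * A i l q r + τ) =
        (σ - τ) ^ 2 * (A i l p r * A i l q r) + ((σ - τ) * τ * A i l p r +
          ((σ - τ) * τ * A i l q r + τ ^ 2)) := fun r => by ring
    simp_rw [e, Finset.sum_add_distrib, ← Finset.mul_sum, (h.design i l hil).row_sum]
    simp
    ring
  have hrhs : ∀ p q, ((A i j * (A i j)ᵀ) * (A i j * (A i j)ᵀ)) p q =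
      ((k : ℤ) - lam₁) ^ 2 * (if p = q then 1 else 0) +
      (2 * ((k : ℤ) - lam₁) * (lam₁ - lam₂) + n * (lam₁ - lam₂) ^ 2) *
        (if p.1 = q.1 then 1 else 0) +
      (2 * ((k : ℤ) - lam₁) * lam₂ + 2 * n * (lam₁ - lam₂) * lam₂ + m * n * lam₂ ^ 2) := by
    intro p q
    rw [← sum_pt_eq, Matrix.mul_apply]
    simp_rw [(h.design i j hij).mul_transpose_apply_eq]
  have key : ∀ p q, _ := fun p q => (hlhs p q).symm.trans ((congrFun₂ hM p q).trans (hrhs p q))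
  simp_rw [(h.design i l hil).mul_transpose_apply] at key
  let p : Pt m n := (⟨0, by omega⟩, ⟨0, by omega⟩)
  let q : Pt m n := (⟨0, by omega⟩, ⟨1, by omega⟩)
  -- Compare the entries at equal points, at points of one class, and at points of two classes.
  let r : Pt m n := (⟨1, by omega⟩, ⟨0, by omega⟩)
  have k1 := key p p
  have k2 := key p q
  have k3 := key p r
  simp [p, q, r] at k1 k2 k3
  have hk : (k : ℤ) - lam₁ ≠ 0 := by
    have := (h.design i j hij).lam₁_ne
    omega
  have hl : (lam₁ : ℤ) - lam₂ ≠ 0 := by omega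
  have h1 : (k : ℤ) - lam₁ = (σ - τ) ^ 2 := by
    apply mul_left_cancel₀ hk
    linear_combination k2 - k1
  refine ⟨h1, mul_left_cancel₀ hl ?_⟩
  linear_combination k3 - k2 - (lam₁ - lam₂ : ℤ) * h1

theorem sigma_ne_tau (h : IsLinkedSystem f v k m n lam₁ lam₂ σ τ A) (hf : 3 ≤ f)
    (hproper : lam₁ ≠ lam₂) : σ - τ ≠ 0 := by
  obtain ⟨i, j, l, hij, hjl, hil⟩ := exists_distinct hf
  intro h0
  have h1 := (h.eigenvalues hf hproper).1
  rw [h0] at h1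
  have := (h.design i j hij).lam₁_ne
  omega

/-- Row sums of `A i j * A j i`, whose eigenvalue `k - lam₁ + n (lam₁ - lam₂)` vanishes. -/
theorem k_sq_eq_lam₂ (h : IsLinkedSystem f v k m n lam₁ lam₂ σ τ A) (hf : 3 ≤ f)
    (hproper : lam₁ ≠ lam₂) : (k : ℤ) ^ 2 = lam₂ * (m * n) := by
  obtain ⟨i, j, l, hij, hjl, hil⟩ := exists_distinct hf
  have hm := (h.design i j hij).two_le_m
  have hn := (h.design i j hij).two_le_n
  let p : Pt m n := (⟨0, by omega⟩, ⟨0, by omega⟩)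
  have h1 : ∑ q, (A i j * (A i j)ᵀ) p q = (k : ℤ) ^ 2 := by
    simp_rw [Matrix.mul_apply]
    rw [Finset.sum_comm]
    simp_rw [← Finset.mul_sum, Matrix.transpose_apply, (h.design i j hij).col_sum,
      ← Finset.sum_mul, (h.design i j hij).row_sum]
    ring
  simp_rw [(h.design i j hij).mul_transpose_apply_eq, Finset.sum_add_distrib, ← Finset.mul_sum,
    sum_ite_class] at h1
  simp at h1
  linear_combination -h1 + (h.eigenvalues hf hproper).2

end IsLinkedSystem

/-! ### The projection system of a linked system -/

theorem classProj_mul_self {m n : ℕ} (hn : n ≠ 0) :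
    classProj m n * classProj m n = classProj m n := by
  ext p q
  rw [classProj_mul_apply]
  have h1 : ∑ x, classProj m n (p.1, x) q = 0 := by
    simp only [classProj, Matrix.of_apply, Finset.sum_sub_distrib]
    by_cases hpq : p.1 = q.1
    · simp [Prod.ext_iff, hpq, hn]
    · simp [Prod.ext_iff, hpq]
  rw [h1]
  ring

theorem classProj_transpose {m n : ℕ} : (classProj m n)ᵀ = classProj m n := by
  ext p q
  simp [classProj, eq_comm]

/-- If `N * Nᵀ` is the projection `classProj`, then `N` maps into its range. -/
theorem classProj_mul_of_mul_transpose {m n : ℕ} (hn : n ≠ 0) {N : Matrix (Pt m n) (Pt m n) ℝ}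
    (h : N * Nᵀ = classProj m n) : classProj m n * N = N := by
  -- For a projection `E = N Nᵀ` one has `(1 - E) N ((1 - E) N)ᵀ = (1 - E) E (1 - E) = 0`.
  have h1 : (N - classProj m n * N) * (N - classProj m n * N)ᴴ = 0 := by
    rw [Matrix.conjTranspose_eq_transpose_of_trivial, Matrix.transpose_sub,
      Matrix.transpose_mul, classProj_transpose, sub_mul, mul_sub, mul_sub, h,
      ← Matrix.mul_assoc, h, classProj_mul_self hn, Matrix.mul_assoc, h, classProj_mul_self hn,
      Matrix.mul_assoc, ← Matrix.mul_assoc N, h, classProj_mul_self hn, classProj_mul_self hn]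
    simp
  exact (sub_eq_zero.1 (Matrix.self_mul_conjTranspose_eq_zero.1 h1)).symm

/-- The incidence matrix `A`, centred so that rows sum to zero when `A` has row sums `k`,
and divided by `s`. -/
noncomputable def centred {m n : ℕ} (k : ℕ) (s : ℤ) (A : Matrix (Pt m n) (Pt m n) ℤ) :
    Matrix (Pt m n) (Pt m n) ℝ :=
  Matrix.of fun p q => ((A p q : ℝ) - k / (m * n)) / s

/-- The centred matrices of a linked system, completed by `classProj` on the diagonal. -/
noncomputable def block {f m n : ℕ} (k : ℕ) (s : ℤ)
    (A : Fin f → Fin f → Matrix (Pt m n) (Pt m n) ℤ) (i j : Fin f) :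
    Matrix (Pt m n) (Pt m n) ℝ :=
  if i = j then classProj m n else centred k s (A i j)

theorem centred_mul_apply {m n k : ℕ} (s : ℤ)
    {A A' : Matrix (Pt m n) (Pt m n) ℤ}
    (hA : ∀ p, ∑ q, A p q = k) (hA' : ∀ q, ∑ p, A' p q = k) (p q : Pt m n) :
    (centred k s A * centred k s A') p q =
      (((A * A') p q : ℤ) - (k : ℝ) ^ 2 / (m * n)) / (s : ℝ) ^ 2 := by
  have hA1 : ∑ q, (A p q : ℝ) = k := by exact_mod_cast hA p
  have hA2 : ∑ p, (A' p q : ℝ) = k := by exact_mod_cast hA' q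
  rw [Matrix.mul_apply, Matrix.mul_apply]
  have e : ∀ r, centred k s A p r * centred k s A' r q = (A p r * A' r q -
      k / (m * n) * A p r - k / (m * n) * A' r q + (k / (m * n)) ^ 2 : ℝ) / s ^ 2 := fun r => by
    simp only [centred, Matrix.of_apply]
    ring
  simp_rw [e, ← Finset.sum_div, Finset.sum_add_distrib, Finset.sum_sub_distrib,
    ← Finset.mul_sum, hA1, hA2]
  congr 1
  simp only [Finset.sum_const, Finset.card_univ, Fintype.card_prod, Fintype.card_fin,
    nsmul_eq_mul]
  push_cast
  field_simp
  ring

namespace IsLinkedSystem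

theorem two_le (h : IsLinkedSystem f v k m n lam₁ lam₂ σ τ A) (hf : 3 ≤ f) : 2 ≤ m ∧ 2 ≤ n := by
  obtain ⟨i, j, l, hij, hjl, hil⟩ := exists_distinct hf
  exact ⟨(h.design i j hij).two_le_m, (h.design i j hij).two_le_n⟩

theorem v_eq (h : IsLinkedSystem f v k m n lam₁ lam₂ σ τ A) (hf : 3 ≤ f) : v = m * n := by
  obtain ⟨i, j, l, hij, hjl, hil⟩ := exists_distinct hf
  exact (h.design i j hij).v_eq

theorem pt_card_ne_zero (h : IsLinkedSystem f v k m n lam₁ lam₂ σ τ A) (hf : 3 ≤ f) :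
    (m : ℝ) * n ≠ 0 := by
  obtain ⟨hm, hn⟩ := h.two_le hf
  positivity

theorem centred_mul_centred (h : IsLinkedSystem f v k m n lam₁ lam₂ σ τ A) (hf : 3 ≤ f)
    (hproper : lam₁ ≠ lam₂) {i j l : Fin f} (hij : i ≠ j) (hjl : j ≠ l) (hil : i ≠ l) :
    centred k (σ - τ) (A i j) * centred k (σ - τ) (A j l) = centred k (σ - τ) (A i l) := by
  have hs : ((σ - τ : ℤ) : ℝ) ≠ 0 := by exact_mod_cast h.sigma_ne_tau hf hproper
  have hmn := h.pt_card_ne_zero hf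
  have hm := left_ne_zero_of_mul hmn
  have hn := right_ne_zero_of_mul hmn
  have hk : (k : ℝ) ^ 2 = (σ - τ : ℤ) * k + τ * (m * n) := by
    have := h.k_sq hf
    rw [h.v_eq hf] at this
    exact_mod_cast this
  ext p q
  rw [centred_mul_apply _ (h.design i j hij).row_sum (h.design j l hjl).col_sum,
    h.mul_apply hij hjl hil, hk]
  simp only [centred, Matrix.of_apply]
  rw [Int.cast_add, Int.cast_mul]
  field_simp
  ring

theorem centred_mul_transpose (h : IsLinkedSystem f v k m n lam₁ lam₂ σ τ A) (hf : 3 ≤ f)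
    (hproper : lam₁ ≠ lam₂) {i j : Fin f} (hij : i ≠ j) :
    centred k (σ - τ) (A i j) * centred k (σ - τ) (A j i) = classProj m n := by
  have hs : ((σ - τ : ℤ) : ℝ) ≠ 0 := by exact_mod_cast h.sigma_ne_tau hf hproper
  have hmn := h.pt_card_ne_zero hf
  have hn : (n : ℝ) ≠ 0 := right_ne_zero_of_mul hmn
  have hk : (k : ℝ) ^ 2 = lam₂ * (m * n) := by exact_mod_cast h.k_sq_eq_lam₂ hf hproper
  obtain ⟨h1, h2⟩ := h.eigenvalues hf hproper
  have h2' : ((lam₁ : ℝ) - lam₂) = - ((σ - τ : ℤ) : ℝ) ^ 2 * (n : ℝ)⁻¹ := by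
    have h3 : ((σ - τ : ℤ) : ℝ) ^ 2 + n * (lam₁ - lam₂) = 0 := by
      rw [h1] at h2
      exact_mod_cast h2
    field_simp
    linarith
  ext p q
  rw [centred_mul_apply _ (h.design i j hij).row_sum (h.design j i hij.symm).col_sum,
    ← h.transpose_eq i j hij, (h.design i j hij).mul_transpose_apply_eq, h1, hk]
  have e : ((((σ - τ) ^ 2 * (if p = q then 1 else 0) +
      ((lam₁ : ℤ) - lam₂) * (if p.1 = q.1 then 1 else 0) + lam₂ : ℤ)) : ℝ) =
      ((σ - τ : ℤ) : ℝ) ^ 2 * (if p = q then 1 else 0) +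
      ((lam₁ : ℝ) - lam₂) * (if p.1 = q.1 then 1 else 0) + lam₂ := by
    push_cast
    rfl
  rw [e, h2', mul_div_cancel_right₀ _ hmn]
  simp only [classProj, Matrix.of_apply]
  split_ifs <;> field_simp <;> ring

theorem isProjectionSystem (h : IsLinkedSystem f v k m n lam₁ lam₂ σ τ A) (hf : 3 ≤ f)
    (hproper : lam₁ ≠ lam₂) :
    IsProjectionSystem ((1 - 2 * (k / (m * n) : ℝ)) / (σ - τ : ℤ))
      ((k / (m * n) - (k / (m * n) : ℝ) ^ 2) / ((σ - τ : ℤ) : ℝ) ^ 2) (block k (σ - τ) A) := by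
  have hs : ((σ - τ : ℤ) : ℝ) ≠ 0 := by exact_mod_cast h.sigma_ne_tau hf hproper
  have hn : n ≠ 0 := by have := (h.two_le hf).2; omega
  have htr : ∀ i j, i ≠ j → (centred k (σ - τ) (A i j))ᵀ = centred k (σ - τ) (A j i) := by
    intro i j hij
    rw [← h.transpose_eq i j hij]
    rfl
  have hl : ∀ i j, i ≠ j →
      classProj m n * centred k (σ - τ) (A i j) = centred k (σ - τ) (A i j) := by
    intro i j hij
    refine classProj_mul_of_mul_transpose hn ?_
    rw [htr i j hij, h.centred_mul_transpose hf hproper hij]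
  refine ⟨fun i => by simp [block], fun i j => ?_, fun i j l => ?_, fun i j hij p q => ?_⟩
  · by_cases hij : i = j
    · simp [block, hij, classProj_transpose]
    · simp [block, hij, Ne.symm hij, htr]
  · by_cases hij : i = j
    · subst hij
      by_cases hil : i = l
      · simp [block, hil, classProj_mul_self hn]
      · simp [block, hil, hl]
    · by_cases hjl : j = l
      · subst hjl
        simp only [block, hij, if_true, if_false]
        rw [← htr j i (Ne.symm hij), ← classProj_transpose, ← Matrix.transpose_mul,
          hl j i (Ne.symm hij)]
      · by_cases hil : i = l
        · subst hil
          simp only [block, hij, Ne.symm hij, if_true, if_false]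
          exact h.centred_mul_transpose hf hproper hij
        · simp only [block, hij, hjl, hil, if_false]
          exact h.centred_mul_centred hf hproper hij hjl hil
  · have h1 : (A i j p q : ℝ) * A i j p q = A i j p q := by
      exact_mod_cast (h.design i j hij).entry_sq p q
    simp only [block, hij, if_false, centred, Matrix.of_apply]
    have hm : (m : ℝ) ≠ 0 := left_ne_zero_of_mul (h.pt_card_ne_zero hf)
    have hn' : (n : ℝ) ≠ 0 := right_ne_zero_of_mul (h.pt_card_ne_zero hf)
    field_simp
    linear_combination ((m : ℝ) * n) ^ 2 * h1

/-- Every block meets every class in the same number `t` of points. -/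
theorem exists_class_intersection (h : IsLinkedSystem f v k m n lam₁ lam₂ σ τ A) (hf : 3 ≤ f)
    (hproper : lam₁ ≠ lam₂) : ∃ t : ℤ, 0 < t ∧ t < n ∧ (k : ℤ) = m * t ∧
      m * t ^ 2 = lam₂ * n ∧ (σ - τ) ^ 2 * (n - 1) = m * t * (n - t) := by
  obtain ⟨i, j, l, hij, hjl, hil⟩ := exists_distinct hf
  obtain ⟨hm, hn⟩ := h.two_le hf
  have hmn := h.pt_card_ne_zero hf
  have hs : ((σ - τ : ℤ) : ℝ) ≠ 0 := by exact_mod_cast h.sigma_ne_tau hf hproper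
  let p : Pt m n := (⟨0, by omega⟩, ⟨0, by omega⟩)
  -- A column of the centred matrix sums to zero over every class.
  have h1 := (h.isProjectionSystem hf hproper).sum_class (by omega) i j p.1 p
  simp only [block, hij, if_false, centred, Matrix.of_apply] at h1
  rw [← Finset.sum_div, div_eq_zero_iff, or_iff_left hs] at h1
  simp only [Finset.sum_sub_distrib, Finset.sum_const, Finset.card_univ, Fintype.card_fin,
    nsmul_eq_mul] at h1
  have hkt : (k : ℤ) = m * ∑ x, A i j (p.1, x) p := by
    have : (k : ℝ) = m * ∑ x, (A i j (p.1, x) p : ℝ) := by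
      rw [sub_eq_zero.1 h1]
      have := left_ne_zero_of_mul hmn
      have := right_ne_zero_of_mul hmn
      field_simp
    exact_mod_cast this
  generalize ∑ x, A i j (p.1, x) p = t at hkt
  have hk0 : (0 : ℤ) < k := by exact_mod_cast (h.design i j hij).k_pos
  have hkv : (k : ℤ) < m * n := by
    have := (h.design i j hij).k_lt
    rw [h.v_eq hf] at this
    exact_mod_cast this
  have hm0 : (0 : ℤ) < m := by omega
  have h2 : m * t ^ 2 = lam₂ * n := by
    apply mul_left_cancel₀ hm0.ne'
    have := h.k_sq_eq_lam₂ hf hproper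
    rw [hkt] at this
    linear_combination this
  refine ⟨t, ?_, ?_, hkt, h2, ?_⟩
  · rw [hkt] at hk0
    exact pos_of_mul_pos_right hk0 hm0.le
  · rw [hkt] at hkv
    exact lt_of_mul_lt_mul_left hkv hm0.le
  · obtain ⟨e1, e2⟩ := h.eigenvalues hf hproper
    linear_combination (1 - n : ℤ) * e1 - e2 + h2 + (n : ℤ) * hkt

end IsLinkedSystem

/-! ### Arithmetic of the parameters -/

/-- Since `n` divides `m (n - 2 t) ²`, it suffices to exclude `m (n - 2 t) ² = n`. There
divisibility by `n - 1` leaves only `m = n`, where `(2 s) ² = m (m + 1)`. -/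
theorem two_mul_le_of_params {m n t s l : ℤ} (hm : 2 ≤ m) (hn : 3 ≤ n) (hu : 0 < n - 2 * t)
    (hl : m * t ^ 2 = l * n) (hs : s ^ 2 * (n - 1) = m * t * (n - t)) :
    2 * n ≤ m * (n - 2 * t) ^ 2 := by
  obtain ⟨u, rfl⟩ : ∃ u, u = n - 2 * t := ⟨_, rfl⟩
  have hw : m * (n - 2 * t) ^ 2 = n * (m * n - 4 * m * t + 4 * l) := by
    linear_combination 4 * hl
  set w := m * n - 4 * m * t + 4 * l with hw_def
  have hs4 : 4 * s ^ 2 * (n - 1) = m * (n ^ 2 - (n - 2 * t) ^ 2) := by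
    linear_combination 4 * hs
  generalize n - 2 * t = u at hu hw hs4
  have hw0 : 0 < w := by
    have : 0 < n * w := by rw [← hw]; positivity
    exact pos_of_mul_pos_right this (by omega)
  rcases (show 1 ≤ w from hw0).eq_or_lt with h1 | h1
  · exfalso
    rw [← h1, mul_one] at hw
    have h2 : 4 * s ^ 2 * (n - 1) = n * (m * n - 1) := by
      rw [hs4]
      linear_combination -hw
    have h3 : n - 1 ∣ m - 1 :=
      ⟨4 * s ^ 2 - m * n - m + 1, by linear_combination -h2⟩
    have h4 : n - 1 ≤ m - 1 := Int.le_of_dvd (by omega) h3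
    have h5 : u = 1 := by
      by_contra h
      have h6 : 2 ≤ u := by omega
      have h7 : 4 ≤ u ^ 2 := by nlinarith
      nlinarith
    subst h5
    have h6 : m = n := by linarith
    subst h6
    have h7 : 4 * s ^ 2 = m * (m + 1) := by
      apply mul_right_cancel₀ (show m - 1 ≠ 0 by omega)
      linear_combination h2
    have h8 : m < 2 * |s| := by
      by_contra! h
      nlinarith [sq_abs s, abs_nonneg s]
    have h9 : 2 * |s| < m + 1 := by
      by_contra! h
      nlinarith [sq_abs s, abs_nonneg s]
    omega
  · rw [hw]
    nlinarith

/-- When the relative bound applies under `2 k < m n`, it is stronger than the absolute one. -/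
theorem absolute_of_relative {m n t s l : ℤ} (g : ℝ) (hm : 2 ≤ m) (hn : 3 ≤ n) (ht : 0 < t)
    (hu : 0 < n - 2 * t) (hl : m * t ^ 2 = l * n) (hs : s ^ 2 * (n - 1) = m * t * (n - t))
    (hg : 0 ≤ g) (hgu : g * (n - 2 * t) ≤ (n - 2) * |(s : ℝ)|) :
    2 * (g + 1) * (m * n - 1) ≤ (m * (n - 1) + 2) * (m * (n - 1) - 1 : ℝ) := by
  have hu2 := two_mul_le_of_params hm hn hu hl hs
  have hmn : 4 ≤ n ∨ 3 ≤ m := by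
    by_contra! h
    have h1 : t = 1 := by omega
    have h2 : n = 3 := by omega
    have h3 : m = 2 := by omega
    subst h1 h2 h3
    norm_num at hu2
  have hpoly : n + 16 ≤ m * (n ^ 2 - 2 * n + 6) := by
    rcases hmn with h | h
    · nlinarith [mul_nonneg (sub_nonneg.2 hm) (show 0 ≤ n ^ 2 - 2 * n + 6 by nlinarith)]
    · nlinarith [mul_nonneg (sub_nonneg.2 h) (show 0 ≤ n ^ 2 - 2 * n + 6 by nlinarith)]
  have hs4 : 4 * s ^ 2 * (n - 1) = m * (n ^ 2 - (n - 2 * t) ^ 2) := by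
    linear_combination 4 * hs
  have hu1 : 1 ≤ n - 2 * t := hu
  have hpolyR : (n : ℝ) + 16 ≤ m * (n ^ 2 - 2 * n + 6) := by exact_mod_cast hpoly
  have hs4R : 4 * (s : ℝ) ^ 2 * (n - 1) = m * (n ^ 2 - (n - 2 * t) ^ 2) := by exact_mod_cast hs4
  have hu1R : (1 : ℝ) ≤ n - 2 * t := by exact_mod_cast hu1
  have hu2R : 2 * (n : ℝ) ≤ m * (n - 2 * t) ^ 2 := by exact_mod_cast hu2
  have hmR : (2 : ℝ) ≤ m := by exact_mod_cast hm
  have hnR : (3 : ℝ) ≤ n := by exact_mod_cast hn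
  generalize (n : ℝ) - 2 * t = u at *
  generalize (n : ℝ) = n at *
  generalize (m : ℝ) = m at *
  have h1 : g ^ 2 * u ^ 2 ≤ (n - 2) ^ 2 * (s : ℝ) ^ 2 := by
    rw [← sq_abs (s : ℝ), ← mul_pow, ← mul_pow]
    exact pow_le_pow_left₀ (by positivity) hgu 2
  have h2 : g ^ 2 * u ^ 2 * (4 * (n - 1)) ≤ (n - 2) ^ 2 * (m * (n ^ 2 - 1)) := by
    calc g ^ 2 * u ^ 2 * (4 * (n - 1)) ≤ (n - 2) ^ 2 * (s : ℝ) ^ 2 * (4 * (n - 1)) :=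
          mul_le_mul_of_nonneg_right h1 (by linarith)
      _ = (n - 2) ^ 2 * (m * (n ^ 2 - u ^ 2)) := by rw [← hs4R]; ring
      _ ≤ _ := by
          refine mul_le_mul_of_nonneg_left (mul_le_mul_of_nonneg_left ?_ (by linarith))
            (sq_nonneg _)
          nlinarith
  have h3 : 8 * n * g ^ 2 ≤ (n - 2) ^ 2 * m ^ 2 * (n + 1) := by
    have h4 : g ^ 2 * (4 * (n - 1)) * (2 * n) ≤ g ^ 2 * (4 * (n - 1)) * (m * u ^ 2) :=
      mul_le_mul_of_nonneg_left hu2R (mul_nonneg (sq_nonneg _) (by linarith))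
    have h5 := mul_le_mul_of_nonneg_left h2 (show 0 ≤ m by linarith)
    refine le_of_mul_le_mul_right ?_ (show 0 < n - 1 by linarith)
    nlinarith
  -- `(n + 1) / (8 n) ≤ (5 / 12) ^ 2` for `n ≥ 3`.
  have h6 : 12 * g ≤ 5 * (m * (n - 2)) := by
    by_contra! h
    have h7 : 0 ≤ m * (n - 2) := mul_nonneg (by linarith) (by linarith)
    have h8 : 25 * (m * (n - 2)) ^ 2 < 144 * g ^ 2 := by nlinarith
    have h9 : 0 < (m * (n - 2)) ^ 2 := by
      have : 0 < m * (n - 2) := mul_pos (by linarith) (by linarith)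
      positivity
    nlinarith
  have h7 : 0 < m * n - 1 := by nlinarith
  have h8 := mul_le_mul_of_nonneg_right h6 h7.le
  have h9 := mul_le_mul_of_nonneg_left hpolyR (show 0 ≤ m by linarith)
  linarith

/-- The absolute bound over the reals, with `b` vectors counted in each of the `F` fibres. -/
theorem cast_absolute_bound {F m n b : ℕ} (hn : 1 ≤ n)
    (h : F * b + 1 ≤ (m * (n - 1) + 1).choose 2 + F) :
    2 * (F : ℝ) * (b - 1) ≤ (m * (n - 1) + 2) * (m * (n - 1) - 1) := by
  have h1 : (F : ℝ) * b + 1 ≤ ((m * (n - 1) + 1).choose 2 : ℕ) + F := by exact_mod_cast h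
  rw [Nat.cast_choose_two] at h1
  push_cast [Nat.cast_sub hn] at h1
  linarith

end LinkedGDD

theorem mainTheorem1 (f v k m n lam₁ lam₂ : ℕ) (σ τ : ℤ)
    (A : Fin f → Fin f → Matrix (LinkedGDD.Pt m n) (LinkedGDD.Pt m n) ℤ)
    (hf : 3 ≤ f) (hproper : lam₁ ≠ lam₂)
    (hA : LinkedGDD.IsLinkedSystem f v k m n lam₁ lam₂ σ τ A) :
    ((m, n) = (k, 2) → (f : ℝ) ≤ (m : ℝ) / 2 + 1) ∧
    ((m, n) ≠ (k, 2) → 0 ≤ (m : ℝ) * n - 2 * k →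
      (f : ℝ) ≤ (((m : ℝ) * (n - 1) + 2) * ((m : ℝ) * (n - 1) - 1)) / (2 * ((m : ℝ) * n - 1))) ∧
    ((m, n) ≠ (k, 2) → (m : ℝ) * n - 2 * k < 0 → τ < σ →
      (f : ℝ) ≤ 1 + ((m : ℝ) * (n - 2)) /
        ((2 * (k : ℝ) - m * n) *
          Real.sqrt (((m : ℝ) * (n - 1)) / ((k : ℝ) * ((m : ℝ) * n - k))))) := by
  obtain ⟨hm, hn⟩ := hA.two_le hf
  have hB := hA.isProjectionSystem hf hproper
  have hs0 := hA.sigma_ne_tau hf hproper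
  obtain ⟨t, ht0, htn, hkt, hl, hs⟩ := hA.exists_class_intersection hf hproper
  have hmR : (2 : ℝ) ≤ m := by exact_mod_cast hm
  have hnR : (2 : ℝ) ≤ n := by exact_mod_cast hn
  have hktR : (k : ℝ) = m * t := by exact_mod_cast hkt
  have hm0 : (m : ℝ) ≠ 0 := by positivity
  have hn0 : (n : ℝ) ≠ 0 := by positivity
  have hkn : (k / (m * n) : ℝ) = t / n := by
    rw [hktR]
    field_simp
  rw [hkn] at hB
  have hsR : ((σ - τ : ℤ) : ℝ) ^ 2 * (n - 1) = m * t * (n - t) := by exact_mod_cast hs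
  have hs0R : ((σ - τ : ℤ) : ℝ) ≠ 0 := by exact_mod_cast hs0
  have htau : τ < σ → (0 : ℝ) < (σ - τ : ℤ) := fun h => by exact_mod_cast sub_pos.2 h
  generalize σ - τ = s at hB hs0 hs hsR hs0R htau
  have hrel := hB.relative_bound hn (by omega) ⟨0, by omega⟩
  rw [Fintype.card_fin] at hrel
  have hrel' : 0 ≤ (n - 2 : ℝ) + (f - 1) * (n - 2 * t) / s := by
    have e1 : (n - 2 : ℝ) + (f - 1) * (n - 2 * t) / s =
        n * (1 - 2 * (n : ℝ)⁻¹ + (f - 1) * ((1 - 2 * (t / n : ℝ)) / s)) := by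
      field_simp
    rw [e1]
    exact mul_nonneg (by linarith) hrel
  have ht0R : (0 : ℝ) < t := by exact_mod_cast ht0
  have htnR : (t : ℝ) < n := by exact_mod_cast htn
  -- For `n = 2` every block has one point in each class, so `k = m`.
  have hn3 : (m, n) ≠ (k, 2) → 3 ≤ n := by
    intro h
    by_contra! h2
    obtain rfl : n = 2 := by omega
    obtain rfl : t = 1 := by push_cast at htn; omega
    exact h (by rw [Prod.mk.injEq]; omega)
  refine ⟨?_, ?_, ?_⟩
  · intro h
    obtain ⟨-, rfl⟩ := Prod.mk.inj h
    have h1 := hB.class_absolute_bound hn (by omega) ⟨0, by omega⟩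
    rw [Fintype.card_fin] at h1
    have h2 := LinkedGDD.cast_absolute_bound (by omega) h1
    push_cast at h2
    have h3 : 2 * (f : ℝ) ≤ m + 2 :=
      le_of_mul_le_mul_right (by linarith) (show (0 : ℝ) < m - 1 by linarith)
    linarith
  · intro h hk
    have hn3' := hn3 h
    have hn3R : (3 : ℝ) ≤ n := by exact_mod_cast hn3'
    have hmn : (0 : ℝ) < 2 * (m * n - 1) := by nlinarith
    rw [le_div_iff₀ hmn]
    have hu : (0 : ℝ) ≤ n - 2 * t := by
      rw [hktR] at hk
      refine nonneg_of_mul_nonneg_right (?_ : (0 : ℝ) ≤ m * (n - 2 * t)) (by linarith)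
      linarith
    by_cases hc : 0 ≤ (1 - 2 * (t / n : ℝ)) / s
    · have hc' : (1 - 2 * (t / n : ℝ)) / s < 1 - 2 * (n : ℝ)⁻¹ := by
        have h1 : (n - 2 * t : ℝ) / s < n - 2 := by
          rcases hs0R.lt_or_gt with hs' | hs'
          · exact (div_nonpos_of_nonneg_of_nonpos hu hs'.le).trans_lt (by linarith)
          · rw [div_lt_iff₀ hs']
            have ht1 : (1 : ℝ) ≤ t := by exact_mod_cast ht0
            by_contra! h2
            have h3 : ((n - 2) * s : ℝ) ≤ n - 2 := by linarith
            have h4 : (s : ℝ) ≤ 1 := by nlinarith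
            have h5 : (s : ℝ) ^ 2 ≤ 1 := by nlinarith
            -- `t (n - t) ≥ n - 1` for `1 ≤ t ≤ n - 1`, hence `s ^ 2 ≥ m ≥ 2`.
            have h6 : (n - 1 : ℝ) ≤ t * (n - t) := by nlinarith
            nlinarith
        calc (1 - 2 * (t / n : ℝ)) / s = (n - 2 * t : ℝ) / s / n := by field_simp
          _ < (n - 2) / n := div_lt_div_of_pos_right h1 (by linarith)
          _ = _ := by field_simp
      have h1 := hB.absolute_bound hn (by omega) ⟨0, by omega⟩ hc hc'
      rw [Fintype.card_fin] at h1
      have h2 := LinkedGDD.cast_absolute_bound (by omega) h1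
      push_cast at h2
      linarith
    -- Here `s < 0`, and the relative bound limits `f` more strictly than the absolute one.
    · have hc1 : (1 - 2 * (t / n : ℝ)) = (n - 2 * t) / n := by field_simp
      rw [hc1] at hc
      have hs' : (s : ℝ) < 0 := by
        by_contra! h1
        exact hc (by positivity)
      have hu' : (0 : ℝ) < n - 2 * t := by
        refine hu.lt_of_ne fun h1 => hc ?_
        rw [← h1]
        simp
      have hf1 : (0 : ℝ) ≤ f - 1 := by
        have : (3 : ℝ) ≤ f := by exact_mod_cast hf
        linarith
      have h2 := LinkedGDD.absolute_of_relative (m := m) (n := n) (t := t) (s := s) (f - 1 : ℝ)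
        (by omega) (by omega) ht0 (by exact_mod_cast hu') hl hs hf1 (by
          rw [abs_of_neg hs']
          push_cast
          have h3 := mul_nonneg_of_nonpos_of_nonpos hs'.le (neg_nonpos.2 hrel')
          have h4 : (s : ℝ) * -(n - 2 + (f - 1) * (n - 2 * t) / s) =
              -(s * (n - 2)) - (f - 1) * (n - 2 * t) := by
            field_simp
            ring
          linarith)
      push_cast at h2
      linarith
  · intro _ hk hst
    have hs' := htau hst
    have hu : (0 : ℝ) < 2 * t - n := by
      rw [hktR] at hk
      refine pos_of_mul_pos_right (?_ : (0 : ℝ) < m * (2 * t - n)) (by linarith)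
      linarith
    have hsqrt : Real.sqrt ((m : ℝ) * (n - 1) / (k * (m * n - k))) = (s : ℝ)⁻¹ := by
      have h1 : (k : ℝ) * (m * n - k) = m * (n - 1) * (s : ℝ) ^ 2 := by
        rw [hktR]
        linear_combination -(m : ℝ) * hsR
      have h2 : (n : ℝ) - 1 ≠ 0 := by linarith
      have h3 : (m : ℝ) * (n - 1) / (m * (n - 1) * (s : ℝ) ^ 2) = (s : ℝ)⁻¹ ^ 2 := by
        field_simp
      rw [h1, h3, Real.sqrt_sq (inv_nonneg.2 hs'.le)]
    rw [hsqrt, hktR]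
    have h1 : (m : ℝ) * (n - 2) / ((2 * (m * t) - m * n) * (s : ℝ)⁻¹) =
        (n - 2) * s / (2 * t - n) := by
      have : (2 * ((m : ℝ) * t) - m * n) = m * (2 * t - n) := by ring
      rw [this]
      field_simp
    rw [h1, ← sub_le_iff_le_add', le_div_iff₀ hu]
    have h2 := mul_nonneg hs'.le hrel'
    have h3 : (s : ℝ) * (n - 2 + (f - 1) * (n - 2 * t) / s) =
        s * (n - 2) + (f - 1) * (n - 2 * t) := by
      field_simp
    linarith
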